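/- **Lemma (Total order).** Single-leader Angelfish satisfies Total order. *Setting.* There are $n$ parties, at most $f$ of them Byzantine, $3f<n$; the others are honest. The network is asynchronous and timers may expire at any time (so all partially synchronous executions are included); the signatures of honest parties cannot be forged; references are collision-free hashes. Rounds are numbered $1,2,\dots$; round $r$ has a predetermined leader $L_r$. A *vertex* has a round, a source, a (possibly empty) block, a propose flag, strong edges (to vertices of the previous round), weak edges (to vertices of earlier rounds), possibly a leader edge, and a set of timeout certificates. The round $r$ vertex of $L_r$ is the round $r$ *leader vertex*; only leader vertices may have a leader edge, which goes to a leader vertex of a round $<r-1$. A *vote* of round $r$ has a propose flag and supports either the round $r-1$ leader vertex or nothing. A timeout certificate $\mathcal{TC}_r$ consists of timeout messages for round $r$ signed by $n-f$ distinct parties. Vertices are disseminated by Byzantine reliable broadcast, with one instance for each source and round: (validity) a vertex broadcast by an honest source is eventually delivered by every honest party; (agreement) if one honest party delivers a vertex, every honest party eventually does; (integrity) an honest party delivers at most once in each instance. Votes, timeouts and certificates are multicast. *Protocol of an honest party $P_i$.* - A delivered well-formed vertex is added to the local graph $DAG_i$ once all the vertices that it references are there. A round $r$ leader vertex is accepted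 only if it has a strong edge to the round $r-1$ leader vertex, or carries $\mathcal{TC}_{r''}$ for all $r'<r''<r$, where $r'$ is the round of its leader edge ($r'=0$ if it has none). - $P_i$ starts in round $1$. It enters round $r+1$ from round $r$ when the numbers of received round $r$ vote signatures (directly or in vote certificates) and of round $r$ vertices in $DAG_i$ add up to at least $n-f$, and from a round $<r$ when they add up to at least $f+1$; in both cases it must have the round $r$ leader vertex or $\mathcal{TC}_r$, and $L_{r+1}$, if it lacks the round $r$ leader vertex, must have the timeout certificates of all rounds up to $r$ after the last round whose leader vertex it has. If its timer expires while its current round's leader vertex is missing, it multicasts a timeout for that round. - In each round that it enters, $P_i$ sends at most one message, a vertex or a vote; $L_r$ never sends a vote in round $r$. Before creating a round $r>1$ vertex, unless it jumped into round $r$, it waits until the number of round $r-1$ vertices in $DAG_i$ is at least the number of parties known to have set the propose flag in round $r-2$, minus $f$. The strong edges of its round $r$ vertex go to all round $r-1$ vertices in $DAG_i$, except the leader vertex if it sent a timeout for round $r-1$; its vote supports the round $r-1$ leader vertex if it has it and did not send that timeout. If its own round $r$ leader vertex has no strong edge to the round $r-1$ leader vertex, it gets a leader edge to the latest leader vertex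 of a round $<r-1$ in $DAG_i$ (if any) and the certificates $\mathcal{TC}$ of all rounds in between. Weak edges go to vertices of $DAG_i$ of rounds $\le r-2$ not reached otherwise; either all vertices of these rounds are then reached or there are at least $n-f$ weak edges. - $P_i$ *directly commits* the round $r$ leader vertex $v\in DAG_i$, if it has not yet directly committed in a round $\ge r$, once at least $n-f$ distinct parties support it, each by the first reliable-broadcast message of a round $r+1$ vertex with a strong edge to the round $r$ leader vertex or by a signed round $r+1$ vote for that vertex (received directly or in a commit vote certificate). It then goes down through the rounds $r-1,r-2,\dots$ to the round after that of its previous direct commit (to round $1$ if there is none), committing each leader vertex in $DAG_i$ that has a leader path from the last vertex committed in this process; a *leader path* is a path through leader vertices along strong edges and leader edges. These leader vertices are processed in increasing order of rounds: for each one, the not yet delivered vertices reachable from it (by strong, weak and leader edges) are output in a fixed deterministic order, a vertex with block $b$, round $r$ and source $P_k$ being output as $\mathsf{a\_deliver}_i(b,r,P_k)$. Byzantine parties behave arbitrarily. *Claim.* In every execution: 1. (Total order) if an honest party $P_i$ outputs $\mathsf{a\_deliver}_i(b,r,P_k)$ before $\mathsf{a\_deliver}_i(b',r',P_\ell)$,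 then no honest party $P_j$ outputs $\mathsf{a\_deliver}_j(b',r',P_\ell)$ before $\mathsf{a\_deliver}_j(b,r,P_k)$. The same holds with the rounds omitted, that is, for the pairs $(b,P_k)$ and $(b',P_\ell)$, where a pair that is output several times counts at its first output: if $P_i$ outputs $(b,P_k)$ before its first output of $(b',P_\ell)$, then no honest $P_j$ outputs $(b',P_\ell)$ before its first output of $(b,P_k)$. 2. If an honest party directly commits a round $r$ leader vertex $v$, then, in the local graph of any honest party at any time, every leader vertex of a round $>r$ has a leader path to $v$. -/

import Mathlib

universe u

namespace Angelfish

/-! ## Data structures -/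

/-- A timeout certificate `TC_r`: signatures of `signers` on the message `⟨timeout, r⟩`. -/
structure TimeoutCert (n : ℕ) where
  round : ℕ
  signers : Finset (Fin n)

/-- A vertex of the DAG. A block is a list of transactions (possibly empty). References are
collision-free hashes, so a vertex is identified with its content together with the vertices
that it references. The lists are used as sets. -/
structure Vertex (n : ℕ) (Tx : Type u) : Type u where
  round : ℕ
  source : Fin n
  block : List Tx
  propose : Bool
  strongEdges : List (Vertex n Tx)
  weakEdges : List (Vertex n Tx)
  leaderEdge : Option (Vertex n Tx)
  tc : List (TimeoutCert n)

noncomputable instance (n : ℕ) (Tx : Type u) : DecidableEq (Vertex n Tx) := Classical.decEq _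

/-- All vertices referenced by `v`. -/
def Vertex.refs {n : ℕ} {Tx : Type u} (v : Vertex n Tx) : List (Vertex n Tx) :=
  v.strongEdges ++ v.weakEdges ++ v.leaderEdge.toList

/-- A vote; `strongEdge` is `none` when the vote supports no leader vertex. -/
structure Vote (n : ℕ) (Tx : Type u) : Type u where
  round : ℕ
  source : Fin n
  propose : Bool
  strongEdge : Option (Vertex n Tx)

/-- The messages that parties multicast. `first v` is the first message of the reliable
broadcast of `v`. The certificates carry the set of parties whose vote signatures they
aggregate: `pvc r Q` (round `r` votes with propose flag true), `npvc r Q` (with flag false),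
`cvc r Q` (round `r` votes for the leader vertex of round `r - 1`). -/
inductive Msg (n : ℕ) (Tx : Type u) : Type u where
  | vote (vt : Vote n Tx)
  | timeout (r : ℕ)
  | first (v : Vertex n Tx)
  | tc (c : TimeoutCert n)
  | pvc (r : ℕ) (signers : Finset (Fin n))
  | npvc (r : ℕ) (signers : Finset (Fin n))
  | cvc (r : ℕ) (signers : Finset (Fin n))

/-- The fixed data of a system of `n` parties: the bound `f` used in the thresholds, the set of
Byzantine parties, the leader of each round, and the deterministic rule by which a finite set of
vertices is listed for delivery. -/
structure System (n : ℕ) (Tx : Type u) where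
  f : ℕ
  byz : Finset (Fin n)
  leader : ℕ → Fin n
  order : Finset (Vertex n Tx) → List (Vertex n Tx)
  order_nodup : ∀ s, (order s).Nodup
  mem_order : ∀ s v, v ∈ order s ↔ v ∈ s

/-- Local variables of a party. Arrays indexed by rounds are functions on `ℕ`; sets of
signatures are the sets of their signers. -/
structure LocalState (n : ℕ) (Tx : Type u) : Type u where
  /-- current round -/
  round : ℕ
  /-- whether the vertex or vote of the current round has been sent -/
  sent : Bool
  /-- whether the current round was entered by a jump -/
  jumped : Bool
  /-- `blocksToPropose` -/
  queue : List (List Tx)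
  dag : Finset (Vertex n Tx)
  buffer : Finset (Vertex n Tx)
  vertexProposers : ℕ → Finset (Fin n)
  sigPropose : ℕ → Finset (Fin n)
  sigNoPropose : ℕ → Finset (Fin n)
  /-- `sigCommit r`: signers of round `r` votes for the leader vertex of round `r - 1` -/
  sigCommit : ℕ → Finset (Fin n)
  /-- rounds for which a timeout message has been sent -/
  timeoutSent : Finset ℕ
  /-- signers of the timeout messages received, individually or inside certificates -/
  timeoutSigs : ℕ → Finset (Fin n)
  /-- first messages received from reliable broadcasts -/
  firstMsgs : Finset (Vertex n Tx)
  committedRound : ℕ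
  delivered : Finset (Vertex n Tx)
  /-- the outputs `a_deliver(block, round, source)`, in the order in which they were made -/
  out : List (List Tx × ℕ × Fin n)

/-- The local state right after `advance_round(1)`. -/
def LocalState.init (n : ℕ) (Tx : Type u) : LocalState n Tx where
  round := 1
  sent := false
  jumped := false
  queue := []
  dag := ∅
  buffer := ∅
  vertexProposers := fun _ => ∅
  sigPropose := fun _ => ∅
  sigNoPropose := fun _ => ∅
  sigCommit := fun _ => ∅
  timeoutSent := ∅
  timeoutSigs := fun _ => ∅
  firstMsgs := ∅
  committedRound := 0
  delivered := ∅
  out := []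

/-- `DAG_i[r]`. -/
def LocalState.layer {n : ℕ} {Tx : Type u} (s : LocalState n Tx) (r : ℕ) :
    Finset (Vertex n Tx) :=
  s.dag.filter (fun v => v.round = r)

/-- `|sigPropose[r]| + |sigNoPropose[r]| + |DAG_i[r]|`. -/
def LocalState.heard {n : ℕ} {Tx : Type u} (s : LocalState n Tx) (r : ℕ) : ℕ :=
  (s.sigPropose r).card + (s.sigNoPropose r).card + (s.layer r).card

/-- The global configuration: the local states (only those of honest parties matter) and the
set of messages multicast so far by honest parties, each with its sender. -/
structure Config (n : ℕ) (Tx : Type u) : Type u where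
  loc : Fin n → LocalState n Tx
  net : Set (Fin n × Msg n Tx)

def Config.init (n : ℕ) (Tx : Type u) : Config n Tx where
  loc := fun _ => LocalState.init n Tx
  net := ∅

/-- Replace the state of party `i` by `s` and add the messages `M`, multicast by `i`. -/
def Config.upd {n : ℕ} {Tx : Type u} (c : Config n Tx) (i : Fin n) (s : LocalState n Tx)
    (M : Set (Msg n Tx)) : Config n Tx where
  loc := Function.update c.loc i s
  net := c.net ∪ (fun m => (i, m)) '' M

namespace System

variable {n : ℕ} {Tx : Type u}

/-! ## Paths and leader vertices -/

/-- Party `i` is honest. -/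
def Honest (S : System n Tx) (i : Fin n) : Prop := i ∉ S.byz

/-- `v` is a leader vertex of round `r`. -/
def IsLeaderVertex (S : System n Tx) (r : ℕ) (v : Vertex n Tx) : Prop :=
  v.round = r ∧ v.source = S.leader r

/-- The party has a round `r` leader vertex in its DAG. -/
def HasLeader (S : System n Tx) (s : LocalState n Tx) (r : ℕ) : Prop :=
  ∃ v ∈ s.dag, S.IsLeaderVertex r v

open Classical in
/-- `get_leader_vertex(r)`. -/
noncomputable def getLeader (S : System n Tx) (s : LocalState n Tx) (r : ℕ) :
    Option (Vertex n Tx) :=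
  if h : S.HasLeader s r then some h.choose else none

/-- `path(v, u)` in the DAG `D`, along strong, weak and leader edges. -/
def Path (D : Finset (Vertex n Tx)) (v u : Vertex n Tx) : Prop :=
  Relation.ReflTransGen (fun a b => b ∈ D ∧ b ∈ a.refs) v u

/-- `leader_path(v, u)` in the DAG `D`: all vertices are leader vertices and all edges are
strong edges or leader edges. -/
def LeaderPath (S : System n Tx) (D : Finset (Vertex n Tx)) (v u : Vertex n Tx) : Prop :=
  S.IsLeaderVertex v.round v ∧
  Relation.ReflTransGen (fun a b => b ∈ D ∧ S.IsLeaderVertex b.round b ∧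
    (b ∈ a.strongEdges ∨ a.leaderEdge = some b)) v u

/-! ## Verification -/

/-- The format of a vertex: strong edges go to the previous round, weak edges to earlier rounds,
and only a leader vertex may have a leader edge, to a leader vertex of a round before the
previous one. -/
def WellFormed (S : System n Tx) (v : Vertex n Tx) : Prop :=
  1 ≤ v.round ∧
  (∀ u ∈ v.strongEdges, u.round + 1 = v.round) ∧
  (∀ u ∈ v.weakEdges, u.round + 1 < v.round) ∧
  (∀ u, v.leaderEdge = some u → S.IsLeaderVertex v.round v ∧
    S.IsLeaderVertex u.round u ∧ u.round + 1 < v.round)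

/-- All signatures in the certificate verify, and they form a quorum: signatures of Byzantine
parties are free, those of honest parties exist only if they were issued. -/
def VerifiedTC (S : System n Tx) (net : Set (Fin n × Msg n Tx)) (c : TimeoutCert n) : Prop :=
  n - S.f ≤ c.signers.card ∧
  ∀ q ∈ c.signers, S.Honest q → (q, Msg.timeout c.round) ∈ net

/-- The vote supports the leader vertex of the previous round. -/
def SupportsLeader (S : System n Tx) (vt : Vote n Tx) : Prop :=
  ∃ u, vt.strongEdge = some u ∧ S.IsLeaderVertex (vt.round - 1) u

/-- All signatures inside the message verify. -/
def Verified (S : System n Tx) (net : Set (Fin n × Msg n Tx)) : Msg n Tx → Prop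
  | .vote _ => True
  | .timeout _ => True
  | .first _ => True
  | .tc c => S.VerifiedTC net c
  | .pvc r Q => ∀ q ∈ Q, S.Honest q →
      ∃ vt : Vote n Tx, (q, Msg.vote vt) ∈ net ∧ vt.round = r ∧ vt.propose = true
  | .npvc r Q => ∀ q ∈ Q, S.Honest q →
      ∃ vt : Vote n Tx, (q, Msg.vote vt) ∈ net ∧ vt.round = r ∧ vt.propose = false
  | .cvc r Q => ∀ q ∈ Q, S.Honest q →
      ∃ vt : Vote n Tx, (q, Msg.vote vt) ∈ net ∧ vt.round = r ∧ S.SupportsLeader vt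

/-- The round of the leader edge, and `0` when there is none. -/
def leaderBase (v : Vertex n Tx) : ℕ := (v.leaderEdge.map Vertex.round).getD 0

/-- `is_valid(v)` for a leader vertex `v` of round `r`: it has a strong edge to the leader vertex
of round `r - 1`, or it carries timeout certificates for all rounds strictly between the round of
its leader edge and `r` (for all rounds from `1` to `r - 1` if it has no leader edge). -/
def IsValid (S : System n Tx) (net : Set (Fin n × Msg n Tx)) (v : Vertex n Tx) : Prop :=
  (∃ u ∈ v.strongEdges, u.source = S.leader (v.round - 1)) ∨
  ∀ r', leaderBase v < r' → r' < v.round → ∃ c ∈ v.tc, c.round = r' ∧ S.VerifiedTC net c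

/-! ## Protocol rules of an honest party -/

/-- The party has received `TC_r`. -/
def HasTC (S : System n Tx) (s : LocalState n Tx) (r : ℕ) : Prop :=
  n - S.f ≤ (s.timeoutSigs r).card

/-- Round `r` may be left: the leader vertex of round `r` or `TC_r` has been received. The leader
of round `r + 1` moreover waits for timeout certificates of all rounds after the last round whose
leader vertex it has. -/
def MayLeave (S : System n Tx) (i : Fin n) (s : LocalState n Tx) (r : ℕ) : Prop :=
  S.HasLeader s r ∨
  (S.HasTC s r ∧ (i = S.leader (r + 1) →
    ∃ r' < r, (r' = 0 ∨ S.HasLeader s r') ∧ ∀ r'', r' < r'' → r'' ≤ r → S.HasTC s r''))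

/-- The leader edge and the certificates that an honest leader puts into a vertex `v` without a
strong edge to the previous leader vertex: the edge goes to its latest leader vertex before the
previous round (if any), with certificates for all rounds in between. -/
def SkipsCorrectly (S : System n Tx) (s : LocalState n Tx) (v : Vertex n Tx) : Prop :=
  (∀ u, v.leaderEdge = some u →
    u ∈ s.dag ∧ S.IsLeaderVertex u.round u ∧ u.round + 1 < v.round) ∧
  (∀ r', leaderBase v < r' → r' + 1 < v.round → ¬ S.HasLeader s r') ∧
  (∀ r', leaderBase v < r' → r' < v.round → ∃ c ∈ v.tc, c.round = r') ∧
  (∀ c ∈ v.tc, leaderBase v < c.round ∧ c.round < v.round ∧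
    n - S.f ≤ c.signers.card ∧ c.signers ⊆ s.timeoutSigs c.round)

/-- Weak edges go to vertices of rounds `≤ v.round - 2` that `v` does not reach otherwise; every
vertex of these rounds is reached, unless `v` already has `n - f` weak edges. -/
def WeakEdgesCorrect (S : System n Tx) (s : LocalState n Tx) (v : Vertex n Tx) : Prop :=
  (∀ u ∈ v.weakEdges, u ∈ s.dag ∧ u.round + 1 < v.round ∧
    ∀ w ∈ v.refs, Path s.dag w u → w = u ∧ w ∉ v.strongEdges ∧ v.leaderEdge ≠ some w) ∧
  (∀ u ∈ s.dag, u.round + 1 < v.round →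
    Path s.dag v u ∨ n - S.f ≤ v.weakEdges.toFinset.card)

open Classical in
/-- `v` is a possible result of `create_new_vertex` by party `i` in its current round. -/
def MayPropose (S : System n Tx) (i : Fin n) (s : LocalState n Tx) (v : Vertex n Tx) : Prop :=
  v.round = s.round ∧ v.source = i ∧ v.block = s.queue.headD [] ∧
  (1 < s.round → s.jumped = false →
    (s.vertexProposers (s.round - 2)).card - S.f ≤ (s.layer (s.round - 1)).card) ∧
  (∀ u, u ∈ v.strongEdges ↔ u ∈ s.dag ∧ u.round + 1 = s.round ∧
    ¬ (s.round - 1 ∈ s.timeoutSent ∧ u.source = S.leader (s.round - 1))) ∧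
  (if i = S.leader s.round ∧ ¬ ∃ u ∈ v.strongEdges, u.source = S.leader (s.round - 1) then
    S.SkipsCorrectly s v
  else v.leaderEdge = none ∧ v.tc = []) ∧
  S.WeakEdgesCorrect s v

/-- `vt` is a possible result of `create_new_vote` by party `i` in its current round. -/
def MayVote (S : System n Tx) (i : Fin n) (s : LocalState n Tx) (vt : Vote n Tx) : Prop :=
  i ≠ S.leader s.round ∧ vt.round = s.round ∧ vt.source = i ∧
  vt.strongEdge =
    if s.round - 1 ∈ s.timeoutSent then none else S.getLeader s (s.round - 1)

/-- All references of `v` are in the DAG. -/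
def Addable (s : LocalState n Tx) (v : Vertex n Tx) : Prop := ∀ u ∈ v.refs, u ∈ s.dag

/-- Move `v` into the DAG. -/
noncomputable def addToDag (s : LocalState n Tx) (v : Vertex n Tx) : LocalState n Tx :=
  { s with dag := insert v s.dag, buffer := s.buffer.erase v }

open Classical in
/-- Reaction to `r_deliver(v, r, k)`. -/
noncomputable def onDeliver (S : System n Tx) (net : Set (Fin n × Msg n Tx))
    (s : LocalState n Tx) (v : Vertex n Tx) (r : ℕ) (k : Fin n) : LocalState n Tx :=
  if v.source = k ∧ v.round = r ∧ S.WellFormed v ∧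
      (v.source = S.leader r → S.IsValid net v) then
    let s' := if v.propose = true then
      { s with vertexProposers :=
          Function.update s.vertexProposers r (insert k (s.vertexProposers r)) } else s
    if Addable s' v then addToDag s' v else { s' with buffer := insert v s'.buffer }
  else s

open Classical in
/-- Reaction to receiving a verified message `m` from `p`. -/
noncomputable def onReceive (S : System n Tx) (s : LocalState n Tx) (p : Fin n) :
    Msg n Tx → LocalState n Tx
  | .vote vt =>
    if vt.source = p then
      let r := vt.round
      { s with
        vertexProposers := if vt.propose = true then
          Function.update s.vertexProposers r (insert p (s.vertexProposers r))
          else s.vertexProposers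
        sigPropose := if vt.propose = true then
          Function.update s.sigPropose r (insert p (s.sigPropose r)) else s.sigPropose
        sigNoPropose := if vt.propose = true then s.sigNoPropose else
          Function.update s.sigNoPropose r (insert p (s.sigNoPropose r))
        sigCommit := if S.SupportsLeader vt then
          Function.update s.sigCommit r (insert p (s.sigCommit r)) else s.sigCommit }
    else s
  | .timeout r =>
    { s with timeoutSigs := Function.update s.timeoutSigs r (insert p (s.timeoutSigs r)) }
  | .first v => if v.source = p then { s with firstMsgs := insert v s.firstMsgs } else s
  | .tc c =>
    { s with timeoutSigs :=
        Function.update s.timeoutSigs c.round (s.timeoutSigs c.round ∪ c.signers) }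
  | .pvc r Q =>
    { s with
      sigPropose := Function.update s.sigPropose r (s.sigPropose r ∪ Q)
      vertexProposers := Function.update s.vertexProposers r (s.vertexProposers r ∪ Q) }
  | .npvc r Q =>
    { s with sigNoPropose := Function.update s.sigNoPropose r (s.sigNoPropose r ∪ Q) }
  | .cvc r Q => { s with sigCommit := Function.update s.sigCommit r (s.sigCommit r ∪ Q) }

/-- The bookkeeping of `advance_round(r)`; the vertex or vote is sent by a later action. -/
def enterRound (s : LocalState n Tx) (r : ℕ) (jumped : Bool) : LocalState n Tx :=
  { s with round := r, sent := false, jumped := jumped }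

/-! ## Commit rule -/

open Classical in
/-- The parties known to support the leader vertex of round `r`: the senders of first messages of
round `r + 1` vertices with a strong edge to it, and the signers of round `r + 1` votes for it. -/
noncomputable def supporters (S : System n Tx) (s : LocalState n Tx) (r : ℕ) : Finset (Fin n) :=
  (s.firstMsgs.filter (fun w => w.round = r + 1 ∧
    ∃ u ∈ w.strongEdges, S.IsLeaderVertex r u)).image Vertex.source ∪ s.sigCommit (r + 1)

/-- Party may directly commit `v`. -/
def MayCommit (S : System n Tx) (s : LocalState n Tx) (v : Vertex n Tx) : Prop :=
  v ∈ s.dag ∧ S.IsLeaderVertex v.round v ∧ s.committedRound < v.round ∧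
  n - S.f ≤ (S.supporters s v.round).card

open Classical in
/-- The loop of `commit_leader`: going down from round `r`, the leader vertices with a leader path
from the last pushed vertex `v'` are pushed on the stack, until the last committed round. -/
noncomputable def pushLeaders (S : System n Tx) (s : LocalState n Tx) :
    ℕ → Vertex n Tx → List (Vertex n Tx) → List (Vertex n Tx)
  | 0, _, stack => stack
  | r + 1, v', stack =>
    if s.committedRound < r + 1 then
      match S.getLeader s (r + 1) with
      | some u =>
        if S.LeaderPath s.dag v' u then pushLeaders S s r u (u :: stack)
        else pushLeaders S s r v' stack
      | none => pushLeaders S s r v' stack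
    else stack

open Classical in
/-- Deliver the part of the causal history of `v` that has not been delivered yet. -/
noncomputable def orderHistory (S : System n Tx) (s : LocalState n Tx) (v : Vertex n Tx) :
    LocalState n Tx :=
  let new := s.dag.filter (fun u => Path s.dag v u ∧ u ∉ s.delivered)
  { s with
    delivered := s.delivered ∪ new
    out := s.out ++ (S.order new).map (fun u => (u.block, u.round, u.source)) }

/-- `commit_leader(v)` followed by `order_vertices()`, which pops the stack. -/
noncomputable def commitLeader (S : System n Tx) (s : LocalState n Tx) (v : Vertex n Tx) :
    LocalState n Tx :=
  (S.pushLeaders s (v.round - 1) v [v]).foldl (fun s' w => S.orderHistory s' w)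
    { s with committedRound := v.round }

end System

/-! ## Executions -/

/-- The actions of honest parties. Byzantine parties act through the messages and the reliable
broadcast deliveries that honest parties receive from them. -/
inductive Action (n : ℕ) (Tx : Type u) : Type u where
  /-- nothing happens at honest parties -/
  | idle
  /-- `i` calls `a_bcast` on the block `b` -/
  | aBcast (i : Fin n) (b : List Tx)
  /-- `i` creates its vertex `v` of the current round and calls `r_bcast(v, v.round)` -/
  | rBcast (i : Fin n) (v : Vertex n Tx)
  /-- `i` multicasts its vote of the current round -/
  | vote (i : Fin n) (vt : Vote n Tx)
  /-- the timer of the current round of `i` expires -/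
  | timeout (i : Fin n)
  /-- `i` multicasts a timeout certificate that it has received -/
  | relayTC (i : Fin n) (c : TimeoutCert n)
  /-- `i` receives the message `m` from `p` -/
  | receive (i p : Fin n) (m : Msg n Tx)
  /-- `i` outputs `r_deliver(v, r, k)` -/
  | rDeliver (i : Fin n) (v : Vertex n Tx) (r : ℕ) (k : Fin n)
  /-- `i` adds a buffered vertex to its DAG -/
  | unbuffer (i : Fin n) (v : Vertex n Tx)
  /-- `i` enters the next round -/
  | advance (i : Fin n)
  /-- `i` jumps to round `r + 1` -/
  | jump (i : Fin n) (r : ℕ)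
  /-- `i` directly commits the leader vertex `v` -/
  | commit (i : Fin n) (v : Vertex n Tx)

namespace System

variable {n : ℕ} {Tx : Type u}

/-- When an action is possible. Delivery times and timers are left to the adversary. -/
def Enabled (S : System n Tx) (c : Config n Tx) : Action n Tx → Prop
  | .idle => True
  | .aBcast i _ => S.Honest i
  | .rBcast i v => S.Honest i ∧ (c.loc i).sent = false ∧ S.MayPropose i (c.loc i) v
  | .vote i vt => S.Honest i ∧ (c.loc i).sent = false ∧ S.MayVote i (c.loc i) vt
  | .timeout i => S.Honest i ∧ ¬ S.HasLeader (c.loc i) (c.loc i).round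
  | .relayTC i tc => S.Honest i ∧ (c.loc i).round ≤ tc.round ∧ n - S.f ≤ tc.signers.card ∧
      tc.signers ⊆ (c.loc i).timeoutSigs tc.round
  | .receive i p m => S.Honest i ∧ (S.Honest p → (p, m) ∈ c.net) ∧ S.Verified c.net m
  | .rDeliver i _ _ _ => S.Honest i
  | .unbuffer i v => S.Honest i ∧ v ∈ (c.loc i).buffer ∧ Addable (c.loc i) v
  | .advance i => S.Honest i ∧ n - S.f ≤ (c.loc i).heard (c.loc i).round ∧
      S.MayLeave i (c.loc i) (c.loc i).round
  | .jump i r => S.Honest i ∧ (c.loc i).round < r ∧ S.f + 1 ≤ (c.loc i).heard r ∧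
      S.MayLeave i (c.loc i) r
  | .commit i v => S.Honest i ∧ S.MayCommit (c.loc i) v

open Classical in
/-- The effect of an action. -/
noncomputable def next (S : System n Tx) (c : Config n Tx) : Action n Tx → Config n Tx
  | .idle => c
  | .aBcast i b => c.upd i { c.loc i with queue := (c.loc i).queue ++ [b] } ∅
  | .rBcast i v => c.upd i
      { addToDag (c.loc i) v with sent := true, queue := (c.loc i).queue.tail } {.first v}
  | .vote i vt => c.upd i { c.loc i with sent := true } {.vote vt}
  | .timeout i => c.upd i
      { c.loc i with timeoutSent := insert (c.loc i).round (c.loc i).timeoutSent }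
      {.timeout (c.loc i).round}
  | .relayTC i tc => c.upd i (c.loc i) {.tc tc}
  | .receive i p m => c.upd i (S.onReceive (c.loc i) p m) ∅
  | .rDeliver i v r k => c.upd i (S.onDeliver c.net (c.loc i) v r k) ∅
  | .unbuffer i v => c.upd i (addToDag (c.loc i) v) ∅
  | .advance i =>
      let s := c.loc i
      c.upd i (enterRound s (s.round + 1) false)
        (if (s.layer s.round).card < n - S.f then
          {.pvc s.round (s.sigPropose s.round), .npvc s.round (s.sigNoPropose s.round)} else ∅)
  | .jump i r => c.upd i (enterRound (c.loc i) (r + 1) true) ∅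
  | .commit i v =>
      let s := c.loc i
      c.upd i (S.commitLeader s v)
        (if (s.firstMsgs.filter (fun w => w.round = v.round + 1 ∧ v ∈ w.strongEdges)).card
            < n - S.f then {.cvc (v.round + 1) (s.sigCommit (v.round + 1))} else ∅)

/-- The configuration after the first `t` actions. -/
noncomputable def run (S : System n Tx) (act : ℕ → Action n Tx) : ℕ → Config n Tx
  | 0 => Config.init n Tx
  | t + 1 => S.next (run S act t) (act t)

/-- Byzantine reliable broadcast, with one instance for each sender `k` and round `r`. -/
structure ReliableBroadcast (S : System n Tx) (act : ℕ → Action n Tx) : Prop where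
  validity : ∀ t k v, act t = .rBcast k v →
    ∀ i, S.Honest i → ∃ t', act t' = .rDeliver i v v.round k
  agreement : ∀ t i v r k, act t = .rDeliver i v r k →
    ∀ j, S.Honest j → ∃ t', act t' = .rDeliver j v r k
  integrity : ∀ t t' i v v' r k, act t = .rDeliver i v r k → act t' = .rDeliver i v' r k → t = t'

/-- An execution of single-leader Angelfish: every action is possible when it is taken, and
vertices are disseminated by reliable broadcast. -/
structure IsExecution (S : System n Tx) (act : ℕ → Action n Tx) : Prop where
  enabled : ∀ t, S.Enabled (S.run act t) (act t)
  rbc : S.ReliableBroadcast act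

/-! ## Total order -/

/-- Party `i` outputs `a_deliver(x)` before `a_deliver(y)`, where `x` and `y` consist of a block,
a round and a creator. -/
def OutputsBefore (S : System n Tx) (act : ℕ → Action n Tx) (i : Fin n)
    (x y : List Tx × ℕ × Fin n) : Prop :=
  ∃ t l₁ l₂, ((S.run act t).loc i).out = l₁ ++ y :: l₂ ∧ x ∈ l₁

/-- Party `i` outputs the block and creator `x` before it outputs the block and creator `y` for
the first time. -/
def OutputsBlockBefore (S : System n Tx) (act : ℕ → Action n Tx) (i : Fin n)
    (x y : List Tx × Fin n) : Prop :=
  ∃ t l₁ l₂, (((S.run act t).loc i).out.map (fun o => (o.1, o.2.2))) = l₁ ++ y :: l₂ ∧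
    x ∈ l₁ ∧ y ∉ l₁

/-- Total order of Byzantine atomic broadcast, for a relation "`i` outputs `x` before `y`". -/
def TotalOrder {α : Type u} (S : System n Tx) (before : Fin n → α → α → Prop) : Prop :=
  ∀ i j, S.Honest i → S.Honest j → ∀ x y, before i x y → ¬ before j y x

/-- Every leader vertex of a round after `v.round` in the DAG of any honest party, at any time,
has a leader path to each leader vertex `v` that some honest party directly commits. -/
def LeadersReachCommitted (S : System n Tx) (act : ℕ → Action n Tx) : Prop :=
  ∀ t i v, act t = .commit i v → ∀ j, S.Honest j → ∀ t',
    ∀ w ∈ ((S.run act t').loc j).dag, S.IsLeaderVertex w.round w → v.round < w.round →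
      S.LeaderPath ((S.run act t').loc j).dag w v

end System

end Angelfish

namespace Angelfish

/-!
Two ideas make the outputs of honest parties comparable.

*Support excludes timeouts.* An honest party supports a round `r` leader vertex only after it has
left round `r`, and only if it did not send a timeout for round `r`; it never sends one later. Any
two quorums of `n - f` parties share an honest party, so no timeout certificate exists for the round
of a directly committed leader vertex `v`. Hence no later leader vertex can justify skipping that
round, and following strong and leader edges downwards from any later leader vertex must hit `v`.

*The outputs are a function of the last committed leader vertex.* Reliable broadcast leaves at most
one vertex per round and source, so the descent of the commit rule depends only on the causal
history of the vertex where it starts. By the first idea the descent from `v` to round `1` passes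
through every directly committed leader vertex of a lower round. The sequences of committed leader
vertices are therefore prefixes of each other, and so are the lists of outputs.
-/

/-! ## Lists and relations -/

/-- `x` occurs in the list `l` before the first occurrence of `y`. -/
def OccursBefore {α : Type*} (l : List α) (x y : α) : Prop :=
  ∃ l₁ l₂, l = l₁ ++ y :: l₂ ∧ x ∈ l₁ ∧ y ∉ l₁

theorem OccursBefore.asymm_of_prefix {α : Type*} {l m : List α} {x y : α}
    (hlm : l <+: m ∨ m <+: l) (hl : OccursBefore l x y) : ¬ OccursBefore m y x := by
  obtain ⟨l₁, l₂, rfl, hx, hy⟩ := hl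
  rintro ⟨m₁, m₂, rfl, hy', hx'⟩
  have hl₁ : l₁ <+: l₁ ++ y :: l₂ := List.prefix_append _ _
  have hm₁ : m₁ <+: m₁ ++ x :: m₂ := List.prefix_append _ _
  have hcomparable : l₁ <+: m₁ ∨ m₁ <+: l₁ := by
    rcases hlm with h | h
    · exact List.prefix_or_prefix_of_prefix (hl₁.trans h) hm₁
    · exact List.prefix_or_prefix_of_prefix hl₁ (hm₁.trans h)
  rcases hcomparable with h | h
  exacts [hx' (h.subset hx), hy (h.subset hy')]

theorem occursBefore_of_nodup {α : Type*} {l l₁ l₂ : List α} {x y : α} (hl : l.Nodup)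
    (h : l = l₁ ++ y :: l₂) (hx : x ∈ l₁) : OccursBefore l x y := by
  subst h
  exact ⟨l₁, l₂, rfl, hx, fun hy => List.disjoint_of_nodup_append hl hy List.mem_cons_self⟩

theorem mem_of_reflTransGen_of_closed {α : Type*} {R : α → α → Prop} {p : α → Prop}
    (hp : ∀ a, p a → ∀ b, R a b → p b) {a b : α} (ha : p a) (h : Relation.ReflTransGen R a b) :
    p b := by
  induction h with
  | refl => exact ha
  | tail _ hbc hb => exact hp _ hb _ hbc

theorem reflTransGen_and_iff_of_closed {α : Type*} {R : α → α → Prop} {p : α → Prop}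
    (hp : ∀ a, p a → ∀ b, R a b → p b) {a b : α} (ha : p a) :
    Relation.ReflTransGen (fun x y => p y ∧ R x y) a b ↔ Relation.ReflTransGen R a b := by
  refine ⟨Relation.ReflTransGen.mono (fun _ _ h => h.2) _ _, fun h => ?_⟩
  induction h with
  | refl => exact .refl
  | tail hab hbc ih =>
    exact ih.tail ⟨hp _ (mem_of_reflTransGen_of_closed hp ha hab) _ hbc, hbc⟩

namespace System

variable {n : ℕ} {Tx : Type u} {S : System n Tx} {act : ℕ → Action n Tx}

theorem totalOrder_of_prefix_or_prefix {α : Type u} {out : Fin n → ℕ → List α}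
    (hout : ∀ i j t t', out i t <+: out j t' ∨ out j t' <+: out i t) :
    S.TotalOrder fun i x y => ∃ t, OccursBefore (out i t) x y := by
  rintro i j - - x y ⟨t₁, h₁⟩ ⟨t₂, h₂⟩
  exact h₁.asymm_of_prefix (hout i j t₁ t₂) h₂

/-! ## Causal histories -/

/-- `u` is in the causal history of `v`. This is `Path` without reference to a local graph. -/
def Reach (v u : Vertex n Tx) : Prop := Relation.ReflTransGen (fun a b => b ∈ a.refs) v u

/-- `b` is a leader vertex to which `a` has a strong edge or a leader edge. -/
def LeaderStep (S : System n Tx) (a b : Vertex n Tx) : Prop :=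
  S.IsLeaderVertex b.round b ∧ (b ∈ a.strongEdges ∨ a.leaderEdge = some b)

/-- There is a leader path from `v` to `u`. This is `LeaderPath` without reference to a local
graph. -/
def LeaderReach (S : System n Tx) (v u : Vertex n Tx) : Prop :=
  S.IsLeaderVertex v.round v ∧ Relation.ReflTransGen S.LeaderStep v u

theorem LeaderStep.mem_refs {a b : Vertex n Tx} (h : S.LeaderStep a b) : b ∈ a.refs := by
  rcases h.2 with h | h <;> simp [Vertex.refs, h]

theorem LeaderReach.reach {v u : Vertex n Tx} (h : S.LeaderReach v u) : Reach v u :=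
  Relation.ReflTransGen.mono (fun _ _ h => h.mem_refs) _ _ h.2

theorem LeaderReach.trans {v u w : Vertex n Tx} (hvu : S.LeaderReach v u)
    (huw : S.LeaderReach u w) : S.LeaderReach v w :=
  ⟨hvu.1, hvu.2.trans huw.2⟩

theorem sizeOf_lt_of_mem_refs {v u : Vertex n Tx} (h : u ∈ v.refs) : sizeOf u < sizeOf v := by
  obtain ⟨r, k, b, p, strong, weak, leader, tc⟩ := v
  simp only [Vertex.refs, List.mem_append, Option.mem_toList] at h
  rw [Vertex.mk.sizeOf_spec]
  rcases h with (h | h) | h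
  · have := List.sizeOf_lt_of_mem h
    omega
  · have := List.sizeOf_lt_of_mem h
    omega
  · rw [h, Option.some.sizeOf_spec]
    omega

theorem finite_setOf_reach (v : Vertex n Tx) : {u | Reach v u}.Finite := by
  have hunion : {u | Reach v u} = {v} ∪ ⋃ w ∈ {w | w ∈ v.refs}, {u | Reach w u} := by
    ext u
    simp [Reach, Relation.ReflTransGen.cases_head_iff (a := v), eq_comm]
  rw [hunion]
  refine (Set.finite_singleton v).union (v.refs.finite_toSet.biUnion fun w hw => ?_)
  exact finite_setOf_reach w
termination_by sizeOf v
decreasing_by exact sizeOf_lt_of_mem_refs hw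

/-- The causal history of `v`, as a finite set. -/
noncomputable def history (v : Vertex n Tx) : Finset (Vertex n Tx) :=
  (finite_setOf_reach v).toFinset

theorem mem_history {v u : Vertex n Tx} : u ∈ history v ↔ Reach v u := by
  rw [history, Set.Finite.mem_toFinset, Set.mem_ofPred_eq]

/-- The DAG contains all vertices that its vertices reference. -/
def RefClosed (D : Finset (Vertex n Tx)) : Prop := ∀ v ∈ D, ∀ u ∈ v.refs, u ∈ D

namespace RefClosed

variable {D : Finset (Vertex n Tx)} {v u : Vertex n Tx}

theorem mem_of_reach (hD : RefClosed D) (hv : v ∈ D) (h : Reach v u) : u ∈ D :=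
  mem_of_reflTransGen_of_closed hD hv h

theorem path_iff (hD : RefClosed D) (hv : v ∈ D) : Path D v u ↔ Reach v u :=
  reflTransGen_and_iff_of_closed hD hv

theorem leaderPath_iff (hD : RefClosed D) (hv : v ∈ D) :
    S.LeaderPath D v u ↔ S.LeaderReach v u :=
  and_congr_right fun _ =>
    reflTransGen_and_iff_of_closed (fun a ha b hab => hD a ha b (LeaderStep.mem_refs hab)) hv

end RefClosed

/-! ## Effects of single steps -/

theorem exists_onReceive_eq (S : System n Tx) (s : LocalState n Tx) (p : Fin n) (m : Msg n Tx) :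
    ∃ proposers sigP sigN sigC sigT first, S.onReceive s p m = { s with
      vertexProposers := proposers, sigPropose := sigP, sigNoPropose := sigN, sigCommit := sigC,
      timeoutSigs := sigT, firstMsgs := first } := by
  unfold onReceive
  cases m <;> dsimp only <;> (try split_ifs) <;> exact ⟨_, _, _, _, _, _, rfl⟩

theorem exists_onDeliver_eq (S : System n Tx) (N : Set (Fin n × Msg n Tx)) (s : LocalState n Tx)
    (v : Vertex n Tx) (r : ℕ) (k : Fin n) :
    ∃ proposers D B, s.dag ⊆ D ∧
      S.onDeliver N s v r k = { s with vertexProposers := proposers, dag := D, buffer := B } := by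
  unfold onDeliver
  split_ifs
  on_goal 3 => exact ⟨_, _, _, subset_rfl, rfl⟩
  all_goals
    dsimp only
    split_ifs
    exacts [⟨_, _, _, Finset.subset_insert _ _, rfl⟩, ⟨_, _, _, subset_rfl, rfl⟩]

theorem exists_commitLeader_eq (S : System n Tx) (s : LocalState n Tx) (v : Vertex n Tx) :
    ∃ d o, S.commitLeader s v =
      { s with committedRound := v.round, delivered := d, out := o } := by
  have hfold : ∀ (l : List (Vertex n Tx)) (s : LocalState n Tx), ∃ d o,
      l.foldl (fun s' w => S.orderHistory s' w) s = { s with delivered := d, out := o } := by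
    intro l
    induction l with
    | nil => exact fun s => ⟨s.delivered, s.out, rfl⟩
    | cons w _ ih => exact fun s => ih (S.orderHistory s w)
  exact hfold _ _

theorem forall_loc_upd {P : Fin n → LocalState n Tx → Prop} {c : Config n Tx} {i : Fin n}
    {s : LocalState n Tx} (hP : ∀ j, P j (c.loc j)) (hs : P i s) (M : Set (Msg n Tx)) (j : Fin n) :
    P j ((c.upd i s M).loc j) :=
  (Function.forall_update_iff c.loc P).2 ⟨hs, fun j _ => hP j⟩ j

/-! ## Messages and accepted vertices -/

theorem net_subset_next (S : System n Tx) (c : Config n Tx) (a : Action n Tx) :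
    c.net ⊆ (S.next c a).net := by
  cases a <;> first | exact subset_rfl | exact Set.subset_union_left

/-- All messages that honest parties multicast during the execution, with their senders. -/
def messages (S : System n Tx) (act : ℕ → Action n Tx) : Set (Fin n × Msg n Tx) :=
  ⋃ t, (S.run act t).net

theorem net_subset_messages (S : System n Tx) (act : ℕ → Action n Tx) (t : ℕ) :
    (S.run act t).net ⊆ S.messages act :=
  Set.subset_iUnion (fun t => (S.run act t).net) t

section Mono

variable {N N' : Set (Fin n × Msg n Tx)} (hN : N ⊆ N')
include hN

theorem VerifiedTC.mono {c : TimeoutCert n} (h : S.VerifiedTC N c) : S.VerifiedTC N' c :=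
  ⟨h.1, fun q hq hq' => hN (h.2 q hq hq')⟩

theorem IsValid.mono {v : Vertex n Tx} (h : S.IsValid N v) : S.IsValid N' v := by
  refine h.imp_right fun h r hr hr' => ?_
  obtain ⟨c, hc, hcr, hc'⟩ := h r hr hr'
  exact ⟨c, hc, hcr, hc'.mono hN⟩

theorem Verified.mono {m : Msg n Tx} (h : S.Verified N m) : S.Verified N' m := by
  cases m with
  | vote | timeout | first => trivial
  | tc => exact VerifiedTC.mono hN h
  | pvc | npvc | cvc =>
    intro q hq hq'
    obtain ⟨vt, hvt, hvt'⟩ := h q hq hq'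
    exact ⟨vt, hN hvt, hvt'⟩

end Mono

/-- The evidence that a party has collected is genuine: the timeout signatures, first messages and
vote signatures of honest parties that it has stored belong to messages in `N`. -/
structure EvidenceGenuine (S : System n Tx) (N : Set (Fin n × Msg n Tx))
    (s : LocalState n Tx) : Prop where
  timeoutSigs : ∀ r, ∀ q ∈ s.timeoutSigs r, S.Honest q → (q, .timeout r) ∈ N
  firstMsgs : ∀ w ∈ s.firstMsgs, S.Honest w.source → (w.source, .first w) ∈ N
  sigCommit : ∀ r, ∀ q ∈ s.sigCommit r, S.Honest q →
    ∃ vt : Vote n Tx, (q, .vote vt) ∈ N ∧ vt.round = r ∧ S.SupportsLeader vt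

theorem EvidenceGenuine.onReceive {N : Set (Fin n × Msg n Tx)} {s : LocalState n Tx}
    (h : S.EvidenceGenuine N s) {p : Fin n} {m : Msg n Tx} (hp : S.Honest p → (p, m) ∈ N)
    (hm : S.Verified N m) : S.EvidenceGenuine N (S.onReceive s p m) := by
  have union_sigs {g : ℕ → Finset (Fin n)} {Q : Finset (Fin n)} {r : ℕ} {P : ℕ → Fin n → Prop}
      (hg : ∀ r, ∀ q ∈ g r, P r q) (hQ : ∀ q ∈ Q, P r q) :
      ∀ r', ∀ q ∈ Function.update g r (g r ∪ Q) r', P r' q :=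
    (Function.forall_update_iff g fun r' A => ∀ q ∈ A, P r' q).2
      ⟨fun q hq => (Finset.mem_union.1 hq).elim (hg r q) (hQ q), fun r' _ => hg r'⟩
  have insert_sig {g : ℕ → Finset (Fin n)} {r : ℕ} {P : ℕ → Fin n → Prop}
      (hg : ∀ r, ∀ q ∈ g r, P r q) (hr : P r p) :
      ∀ r', ∀ q ∈ Function.update g r (insert p (g r)) r', P r' q :=
    (Function.forall_update_iff g fun r' A => ∀ q ∈ A, P r' q).2
      ⟨(Finset.forall_mem_insert _ _ _).2 ⟨hr, hg r⟩, fun r' _ => hg r'⟩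
  cases m with
  | vote vt =>
    unfold System.onReceive
    dsimp only
    split_ifs with _ _ hsupp hsupp
    · exact ⟨h.1, h.2, insert_sig h.3 fun hq => ⟨vt, hp hq, rfl, hsupp⟩⟩
    · exact ⟨h.1, h.2, h.3⟩
    · exact ⟨h.1, h.2, insert_sig h.3 fun hq => ⟨vt, hp hq, rfl, hsupp⟩⟩
    · exact ⟨h.1, h.2, h.3⟩
    · exact h
  | timeout r => exact ⟨insert_sig h.1 hp, h.2, h.3⟩
  | first v =>
    unfold System.onReceive
    dsimp only
    split_ifs with hv
    · exact ⟨h.1, (Finset.forall_mem_insert _ _ _).2 ⟨hv ▸ hp, h.2⟩, h.3⟩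
    · exact h
  | tc c => exact ⟨union_sigs h.1 hm.2, h.2, h.3⟩
  | pvc | npvc => exact ⟨h.1, h.2, h.3⟩
  | cvc r Q => exact ⟨h.1, h.2, union_sigs h.3 hm⟩

theorem evidenceGenuine_next {N : Set (Fin n × Msg n Tx)} {c : Config n Tx} {a : Action n Tx}
    (hen : S.Enabled c a) (hN : c.net ⊆ N) (h : ∀ i, S.EvidenceGenuine N (c.loc i)) :
    ∀ i, S.EvidenceGenuine N ((S.next c a).loc i) := by
  cases a with
  | idle => exact h
  | receive i p m =>
    exact forall_loc_upd h ((h i).onReceive (fun hp => hN (hen.2.1 hp)) (hen.2.2.mono hN)) _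
  | rDeliver i v r k =>
    obtain ⟨_, _, _, -, heq⟩ := exists_onDeliver_eq S c.net (c.loc i) v r k
    exact forall_loc_upd h (heq ▸ ⟨(h i).1, (h i).2, (h i).3⟩) _
  | commit i v =>
    obtain ⟨_, _, heq⟩ := exists_commitLeader_eq S (c.loc i) v
    exact forall_loc_upd h (heq ▸ ⟨(h i).1, (h i).2, (h i).3⟩) _
  | _ i =>
    refine forall_loc_upd h ?_ _
    exact ⟨(h i).1, (h i).2, (h i).3⟩

theorem evidenceGenuine_run (hact : S.IsExecution act) (t : ℕ) (i : Fin n) :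
    S.EvidenceGenuine (S.messages act) ((S.run act t).loc i) := by
  induction t generalizing i with
  | zero => constructor <;> simp [run, Config.init, LocalState.init]
  | succ t ih => exact evidenceGenuine_next (hact.enabled t) (S.net_subset_messages act t) ih i

/-- An honest party has delivered `v` by reliable broadcast, and `v` passes the checks that honest
parties make on delivery. -/
structure Accepted (S : System n Tx) (act : ℕ → Action n Tx) (v : Vertex n Tx) : Prop where
  delivered : ∃ t i, S.Honest i ∧ act t = .rDeliver i v v.round v.source
  wellFormed : S.WellFormed v
  isValid : v.source = S.leader v.round → S.IsValid (S.messages act) v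

theorem Accepted.eq_of_round_source (hrbc : S.ReliableBroadcast act) {v u : Vertex n Tx}
    (hv : S.Accepted act v) (hu : S.Accepted act u) (hround : v.round = u.round)
    (hsource : v.source = u.source) : v = u := by
  obtain ⟨t, i, -, ht⟩ := hv.delivered
  obtain ⟨t', j, hj, ht'⟩ := hu.delivered
  obtain ⟨t'', ht''⟩ := hrbc.agreement t i v _ _ ht j hj
  rw [hround, hsource] at ht''
  obtain rfl := hrbc.integrity _ _ _ _ _ _ _ ht' ht''
  cases ht'.symm.trans ht''
  rfl

theorem Accepted.eq_of_isLeaderVertex (hrbc : S.ReliableBroadcast act) {v u : Vertex n Tx} {r : ℕ}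
    (hv : S.Accepted act v) (hu : S.Accepted act u) (hvr : S.IsLeaderVertex r v)
    (hur : S.IsLeaderVertex r u) : v = u :=
  hv.eq_of_round_source hrbc hu (hvr.1.trans hur.1.symm) (hvr.2.trans hur.2.symm)

/-- What is known about the local graph of an honest party: its vertices have been accepted, and it
contains all vertices that they reference. -/
structure IsLocalDag (S : System n Tx) (act : ℕ → Action n Tx) (D : Finset (Vertex n Tx)) :
    Prop where
  accepted : ∀ v ∈ D, S.Accepted act v
  closed : RefClosed D

theorem IsLocalDag.insert {D : Finset (Vertex n Tx)} (hD : S.IsLocalDag act D) {v : Vertex n Tx}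
    (hv : S.Accepted act v) (hrefs : ∀ u ∈ v.refs, u ∈ D) : S.IsLocalDag act (insert v D) :=
  ⟨(Finset.forall_mem_insert _ _ _).2 ⟨hv, hD.accepted⟩,
    (Finset.forall_mem_insert _ _ _).2 ⟨fun u hu => Finset.mem_insert_of_mem (hrefs u hu),
      fun w hw u hu => Finset.mem_insert_of_mem (hD.closed w hw u hu)⟩⟩

section Propose

variable {i : Fin n} {s : LocalState n Tx} {v : Vertex n Tx}

theorem MayPropose.leader_and_skipsCorrectly {u : Vertex n Tx} (h : S.MayPropose i s v)
    (hu : v.leaderEdge = some u) : v.source = S.leader v.round ∧ S.SkipsCorrectly s v := by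
  obtain ⟨hround, hsource, -, -, -, hskip, -⟩ := h
  split_ifs at hskip with hleader
  · exact ⟨by rw [hsource, hround, hleader.1], hskip⟩
  · simp [hskip.1] at hu

theorem MayPropose.wellFormed (h : S.MayPropose i s v) (hs : 1 ≤ s.round) : S.WellFormed v := by
  have ⟨hround, _, _, _, hstrong, _, hweak, _⟩ := h
  refine ⟨hround ▸ hs, fun u hu => hround ▸ ((hstrong u).1 hu).2.1,
    fun u hu => (hweak u hu).2.1, fun u hu => ?_⟩
  have ⟨hleader, hskip⟩ := h.leader_and_skipsCorrectly hu
  exact ⟨⟨rfl, hleader⟩, (hskip.1 u hu).2⟩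

theorem MayPropose.addable (h : S.MayPropose i s v) : Addable s v := by
  have ⟨_, _, _, _, hstrong, _, hweak, _⟩ := h
  intro u hu
  simp only [Vertex.refs, List.mem_append, Option.mem_toList] at hu
  rcases hu with (hu | hu) | hu
  · exact ((hstrong u).1 hu).1
  · exact (hweak u hu).1
  · exact ((h.leader_and_skipsCorrectly hu).2.1 u hu).1

theorem MayPropose.isValid {N : Set (Fin n × Msg n Tx)} (h : S.MayPropose i s v)
    (hs : S.EvidenceGenuine N s) (hleader : v.source = S.leader v.round) : S.IsValid N v := by
  obtain ⟨hround, hsource, -, -, -, hskip, -⟩ := h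
  split_ifs at hskip with hcond
  · refine .inr fun r hr hr' => ?_
    obtain ⟨c, hc, rfl⟩ := hskip.2.2.1 r hr hr'
    obtain ⟨-, -, hquorum, hsub⟩ := hskip.2.2.2 c hc
    exact ⟨c, hc, rfl, hquorum, fun q hq => hs.timeoutSigs _ q (hsub hq)⟩
  · rw [← hsource, ← hround, not_and_not_right] at hcond
    exact .inl (hcond hleader)

theorem MayPropose.accepted (h : S.MayPropose i s v) (hact : S.IsExecution act) {t : ℕ}
    (ht : act t = .rBcast i v) (hi : S.Honest i) (hs : S.EvidenceGenuine (S.messages act) s)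
    (hround : 1 ≤ s.round) : S.Accepted act v := by
  obtain ⟨t', ht'⟩ := hact.rbc.validity t i v ht i hi
  exact ⟨⟨t', i, hi, by rw [ht', h.2.1]⟩, h.wellFormed hround, h.isValid hs⟩

end Propose

/-- What is known about the round, the local graph and the buffer of an honest party. -/
structure DagInv (S : System n Tx) (act : ℕ → Action n Tx) (s : LocalState n Tx) : Prop where
  one_le_round : 1 ≤ s.round
  isLocalDag : S.IsLocalDag act s.dag
  accepted_buffer : ∀ v ∈ s.buffer, S.Accepted act v

theorem DagInv.addToDag {s : LocalState n Tx} (h : S.DagInv act s) {v : Vertex n Tx}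
    (hv : S.Accepted act v) (hrefs : Addable s v) : S.DagInv act (addToDag s v) :=
  ⟨h.one_le_round, h.isLocalDag.insert hv hrefs,
    fun u hu => h.accepted_buffer u (Finset.mem_of_mem_erase hu)⟩

theorem DagInv.onDeliver {s : LocalState n Tx} (h : S.DagInv act s) {N : Set (Fin n × Msg n Tx)}
    (hN : N ⊆ S.messages act) {t r : ℕ} {i k : Fin n} {v : Vertex n Tx} (hi : S.Honest i)
    (ht : act t = .rDeliver i v r k) : S.DagInv act (S.onDeliver N s v r k) := by
  unfold System.onDeliver
  split_ifs with hcheck hpropose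
  on_goal 3 => exact h
  all_goals
    obtain ⟨rfl, rfl, hwf, hvalid⟩ := hcheck
    have hv : S.Accepted act v := ⟨⟨t, i, hi, ht⟩, hwf, fun hl => (hvalid hl).mono hN⟩
    dsimp only
    split_ifs with hrefs
    · have hdag := h.addToDag hv hrefs
      exact ⟨hdag.1, hdag.2, hdag.3⟩
    · exact ⟨h.1, h.2, (Finset.forall_mem_insert _ _ _).2 ⟨hv, h.3⟩⟩

theorem dagInv_next (hact : S.IsExecution act) {t : ℕ}
    (h : ∀ i, S.DagInv act ((S.run act t).loc i)) :
    ∀ i, S.DagInv act ((S.run act (t + 1)).loc i) := by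
  have hen := hact.enabled t
  rw [run]
  cases ha : act t with rw [ha] at hen
  | idle => exact h
  | rBcast i v =>
    obtain ⟨hi, -, hv⟩ := hen
    have hacc := hv.accepted hact ha hi (evidenceGenuine_run hact t i) (h i).one_le_round
    have hdag := (h i).addToDag hacc hv.addable
    refine forall_loc_upd h ?_ _
    exact ⟨hdag.1, hdag.2, hdag.3⟩
  | receive i p m =>
    obtain ⟨_, _, _, _, _, _, heq⟩ := exists_onReceive_eq S ((S.run act t).loc i) p m
    exact forall_loc_upd h (heq ▸ ⟨(h i).1, (h i).2, (h i).3⟩) _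
  | rDeliver i v r k =>
    exact forall_loc_upd h ((h i).onDeliver (S.net_subset_messages act t) hen ha) _
  | unbuffer i v =>
    exact forall_loc_upd h ((h i).addToDag ((h i).accepted_buffer v hen.2.1) hen.2.2) _
  | commit i v =>
    obtain ⟨_, _, heq⟩ := exists_commitLeader_eq S ((S.run act t).loc i) v
    exact forall_loc_upd h (heq ▸ ⟨(h i).1, (h i).2, (h i).3⟩) _
  | advance i | jump i =>
    refine forall_loc_upd h ?_ _
    exact ⟨Nat.succ_pos _, (h i).2, (h i).3⟩
  | _ i =>
    refine forall_loc_upd h ?_ _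
    exact ⟨(h i).1, (h i).2, (h i).3⟩

theorem dagInv_run (hact : S.IsExecution act) (t : ℕ) (i : Fin n) :
    S.DagInv act ((S.run act t).loc i) := by
  induction t generalizing i with
  | zero => exact ⟨le_rfl, ⟨by simp [run, Config.init, LocalState.init], nofun⟩, nofun⟩
  | succ t ih => exact dagInv_next hact ih i

/-! ## Support excludes timeouts -/

/-- The sender of the message supports a leader vertex of round `r`: the message is the first
message of a round `r + 1` vertex with a strong edge to it, or a round `r + 1` vote for it. -/
def Supports (S : System n Tx) (r : ℕ) : Msg n Tx → Prop
  | .first w => w.round = r + 1 ∧ ∃ u ∈ w.strongEdges, S.IsLeaderVertex r u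
  | .vote vt => vt.round = r + 1 ∧ S.SupportsLeader vt
  | _ => False

/-- What a message says about the local state of its honest sender: the sender has recorded the
rounds of its timeouts, and has left each round whose leader vertex it supports, without having
sent a timeout for it. -/
def Reflects (S : System n Tx) (s : LocalState n Tx) (m : Msg n Tx) : Prop :=
  (∀ r, m = .timeout r → r ∈ s.timeoutSent) ∧
  ∀ r, S.Supports r m → r ∉ s.timeoutSent ∧ r < s.round

theorem Reflects.mono {s s' : LocalState n Tx} {m : Msg n Tx} (h : S.Reflects s m)
    (hround : s.round ≤ s'.round) (hold : s.timeoutSent ⊆ s'.timeoutSent)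
    (hnew : s'.timeoutSent ⊆ insert s.round s.timeoutSent) : S.Reflects s' m := by
  refine ⟨fun r hr => hold (h.1 r hr), fun r hr => ?_⟩
  obtain ⟨hr, hlt⟩ := h.2 r hr
  exact ⟨fun hr' => (Finset.mem_insert.1 (hnew hr')).elim hlt.ne hr, hlt.trans_le hround⟩

theorem MayPropose.reflects_first {i : Fin n} {s : LocalState n Tx} {v : Vertex n Tx}
    (h : S.MayPropose i s v) : S.Reflects s (.first v) := by
  obtain ⟨hround, -, -, -, hstrong, -⟩ := h
  refine ⟨nofun, fun r ⟨hr, u, hu, hleader⟩ => ?_⟩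
  obtain ⟨-, -, hexcluded⟩ := (hstrong u).1 hu
  obtain rfl : r = s.round - 1 := by omega
  exact ⟨fun hr' => hexcluded ⟨hr', hleader.2⟩, by omega⟩

theorem MayVote.reflects_vote {i : Fin n} {s : LocalState n Tx} {vt : Vote n Tx}
    (h : S.MayVote i s vt) : S.Reflects s (.vote vt) := by
  obtain ⟨-, hround, -, hedge⟩ := h
  refine ⟨nofun, fun r ⟨hr, u, hu, _⟩ => ?_⟩
  obtain rfl : r = s.round - 1 := by omega
  split_ifs at hedge with hsent
  · simp [hu] at hedge
  · exact ⟨hsent, by omega⟩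

/-- Every message that honest parties have sent is reflected by the state of its sender. -/
def NetReflected (S : System n Tx) (c : Config n Tx) : Prop :=
  ∀ q m, (q, m) ∈ c.net → S.Reflects (c.loc q) m

theorem NetReflected.upd {c : Config n Tx} (h : S.NetReflected c) {i : Fin n}
    {s : LocalState n Tx} {M : Set (Msg n Tx)}
    (hold : ∀ m, S.Reflects (c.loc i) m → S.Reflects s m) (hnew : ∀ m ∈ M, S.Reflects s m) :
    S.NetReflected (c.upd i s M) := by
  rintro q m (hm | ⟨m, hm, ⟨⟩⟩)
  · exact forall_loc_upd (P := fun q s => (q, m) ∈ c.net → S.Reflects s m)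
      (fun q => h q m) (fun hm => hold m (h i m hm)) M q hm
  · simpa [Config.upd] using hnew m hm

theorem NetReflected.next {c : Config n Tx} {a : Action n Tx} (h : S.NetReflected c)
    (hen : S.Enabled c a) : S.NetReflected (S.next c a) := by
  cases a with
  | idle => exact h
  | rBcast i v =>
    exact h.upd (fun m hm => ⟨hm.1, hm.2⟩) fun m hm => hm ▸ hen.2.2.reflects_first
  | vote i vt =>
    exact h.upd (fun m hm => ⟨hm.1, hm.2⟩) fun m hm => hm ▸ hen.2.2.reflects_vote
  | timeout i =>
    refine h.upd (fun m hm => hm.mono le_rfl (Finset.subset_insert _ _) subset_rfl) ?_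
    rintro _ rfl
    exact ⟨fun r hr => by cases hr; exact Finset.mem_insert_self _ _, nofun⟩
  | relayTC i c =>
    refine h.upd (fun m hm => hm) ?_
    rintro _ rfl
    exact ⟨nofun, nofun⟩
  | receive i p m =>
    obtain ⟨_, _, _, _, _, _, heq⟩ := exists_onReceive_eq S (c.loc i) p m
    exact h.upd (heq ▸ fun m hm => ⟨hm.1, hm.2⟩) nofun
  | rDeliver i v r k =>
    obtain ⟨_, _, _, -, heq⟩ := exists_onDeliver_eq S c.net (c.loc i) v r k
    exact h.upd (heq ▸ fun m hm => ⟨hm.1, hm.2⟩) nofun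
  | advance i =>
    refine h.upd (fun m hm => hm.mono (Nat.le_succ _) subset_rfl (Finset.subset_insert _ _)) ?_
    split_ifs
    · rintro _ (rfl | rfl) <;> exact ⟨nofun, nofun⟩
    · exact nofun
  | jump i r =>
    exact h.upd (fun m hm => hm.mono (hen.2.1.le.trans (Nat.le_succ _)) subset_rfl
      (Finset.subset_insert _ _)) nofun
  | commit i v =>
    obtain ⟨_, _, heq⟩ := exists_commitLeader_eq S (c.loc i) v
    refine h.upd (heq ▸ fun m hm => ⟨hm.1, hm.2⟩) ?_
    split_ifs
    · rintro _ rfl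
      exact ⟨nofun, nofun⟩
    · exact nofun
  | aBcast | unbuffer => exact h.upd (fun m hm => ⟨hm.1, hm.2⟩) nofun

theorem netReflected_run (hact : S.IsExecution act) (t : ℕ) : S.NetReflected (S.run act t) := by
  induction t with
  | zero => exact nofun
  | succ t ih => exact ih.next (hact.enabled t)

theorem timeout_notMem_messages_of_supports (hact : S.IsExecution act) {q : Fin n}
    {m : Msg n Tx} {r : ℕ} (hm : (q, m) ∈ S.messages act) (hsupp : S.Supports r m) :
    (q, .timeout r) ∉ S.messages act := by
  intro htimeout
  obtain ⟨t, ht⟩ := Set.mem_iUnion.1 hm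
  obtain ⟨t', ht'⟩ := Set.mem_iUnion.1 htimeout
  have hmono : Monotone fun t => (S.run act t).net :=
    monotone_nat_of_le_succ fun t => S.net_subset_next _ (act t)
  have hreflected := netReflected_run hact (max t t') q
  exact ((hreflected m (hmono (le_max_left t t') ht)).2 r hsupp).1
    ((hreflected _ (hmono (le_max_right t t') ht')).1 r rfl)

theorem EvidenceGenuine.exists_supports {N : Set (Fin n × Msg n Tx)} {s : LocalState n Tx}
    (hs : S.EvidenceGenuine N s) {r : ℕ} {q : Fin n} (hq : S.Honest q)
    (hsupp : q ∈ S.supporters s r) : ∃ m, (q, m) ∈ N ∧ S.Supports r m := by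
  classical
  rcases Finset.mem_union.1 hsupp with h | h
  · obtain ⟨w, hw, rfl⟩ := Finset.mem_image.1 h
    obtain ⟨hw, hround, hstrong⟩ := Finset.mem_filter.1 hw
    exact ⟨_, hs.firstMsgs w hw hq, hround, hstrong⟩
  · obtain ⟨vt, hvt, hsupports⟩ := hs.sigCommit _ q h hq
    exact ⟨_, hvt, hsupports⟩

theorem exists_honest_mem_inter (hn : S.byz.card + 2 * S.f < n) {Q Q' : Finset (Fin n)}
    (hQ : n - S.f ≤ Q.card) (hQ' : n - S.f ≤ Q'.card) : ∃ q, S.Honest q ∧ q ∈ Q ∧ q ∈ Q' := by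
  have hunion := card_finset_fin_le (Q ∪ Q')
  have hinter := Finset.card_union_add_card_inter Q Q'
  obtain ⟨q, hq, hhonest⟩ := Finset.exists_mem_notMem_of_card_lt_card
    (show S.byz.card < (Q ∩ Q').card by omega)
  exact ⟨q, hhonest, Finset.mem_inter.1 hq⟩

theorem not_verifiedTC_of_quorum_supporters (hn : S.byz.card + 2 * S.f < n)
    (hact : S.IsExecution act) {s : LocalState n Tx}
    (hs : S.EvidenceGenuine (S.messages act) s) {r : ℕ}
    (hquorum : n - S.f ≤ (S.supporters s r).card) (c : TimeoutCert n) (hc : c.round = r) :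
    ¬ S.VerifiedTC (S.messages act) c := by
  rintro ⟨hsigners, hgenuine⟩
  obtain ⟨q, hq, hqsupp, hqsigner⟩ := exists_honest_mem_inter hn hquorum hsigners
  obtain ⟨m, hm, hsupp⟩ := hs.exists_supports hq hqsupp
  exact timeout_notMem_messages_of_supports hact hm hsupp (hc ▸ hgenuine q hqsigner hq)

/-! ## Leader paths to committed leader vertices -/

theorem exists_leaderStep {N : Set (Fin n × Msg n Tx)} {w : Vertex n Tx} {r : ℕ}
    (hwf : S.WellFormed w) (hvalid : S.IsValid N w)
    (hTC : ∀ c : TimeoutCert n, c.round = r → ¬ S.VerifiedTC N c) (hr : 1 ≤ r)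
    (hrw : r < w.round) : ∃ u, S.LeaderStep w u ∧ r ≤ u.round ∧ u.round < w.round := by
  obtain ⟨-, hstrong, -, hedge⟩ := hwf
  rcases hvalid with ⟨u, hu, husource⟩ | hskip
  · have hround := hstrong u hu
    have hleader : S.IsLeaderVertex u.round u := ⟨rfl, by rw [husource, ← hround]; rfl⟩
    exact ⟨u, ⟨hleader, .inl hu⟩, by omega, by omega⟩
  · have hbase : r ≤ leaderBase w := by
      by_contra! hlt
      obtain ⟨c, -, hround, hverified⟩ := hskip r hlt hrw
      exact hTC c hround hverified
    cases hu : w.leaderEdge with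
    | none =>
      simp only [leaderBase, hu, Option.map_none, Option.getD_none] at hbase
      omega
    | some u =>
      simp only [leaderBase, hu, Option.map_some, Option.getD_some] at hbase
      obtain ⟨-, hleader, hlt⟩ := hedge u hu
      exact ⟨u, ⟨hleader, .inr hu⟩, hbase, by omega⟩

theorem IsLocalDag.leaderReach {D : Finset (Vertex n Tx)} {v w : Vertex n Tx}
    (hD : S.IsLocalDag act D) (hrbc : S.ReliableBroadcast act) (hv : S.Accepted act v)
    (hvleader : S.IsLeaderVertex v.round v)
    (hTC : ∀ c : TimeoutCert n, c.round = v.round → ¬ S.VerifiedTC (S.messages act) c)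
    (hw : w ∈ D) (hwleader : S.IsLeaderVertex w.round w) (hvw : v.round ≤ w.round) :
    S.LeaderReach w v := by
  induction hk : w.round using Nat.strong_induction_on generalizing w with
  | _ k ih =>
    have hwacc := hD.accepted w hw
    rcases hvw.eq_or_lt with heq | hlt
    · obtain rfl := hwacc.eq_of_isLeaderVertex hrbc hv hwleader (heq ▸ hvleader)
      exact ⟨hwleader, .refl⟩
    · obtain ⟨u, hstep, hvu, huw⟩ := exists_leaderStep hwacc.wellFormed
        (hwacc.isValid hwleader.2) hTC hv.wellFormed.1 hlt
      have hu := hD.closed w hw u hstep.mem_refs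
      exact ⟨hwleader, (ih u.round (hk ▸ huw) hu hstep.1 hvu rfl).2.head hstep⟩

/-- At some time, some party may directly commit `v`. The party is honest, because the local states
of Byzantine parties never change. -/
def Committable (S : System n Tx) (act : ℕ → Action n Tx) (v : Vertex n Tx) : Prop :=
  ∃ t i, S.MayCommit ((S.run act t).loc i) v

namespace Committable

variable {v : Vertex n Tx}

theorem isLeaderVertex (hv : S.Committable act v) : S.IsLeaderVertex v.round v := by
  obtain ⟨_, _, -, hleader, -⟩ := hv
  exact hleader

theorem exists_isLocalDag (hv : S.Committable act v) (hact : S.IsExecution act) :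
    ∃ D, v ∈ D ∧ S.IsLocalDag act D := by
  obtain ⟨t, i, hmem, -⟩ := hv
  exact ⟨_, hmem, (dagInv_run hact t i).isLocalDag⟩

theorem leaderReach (hv : S.Committable act v) (hn : S.byz.card + 2 * S.f < n)
    (hact : S.IsExecution act) {D : Finset (Vertex n Tx)} (hD : S.IsLocalDag act D)
    {w : Vertex n Tx} (hw : w ∈ D) (hwleader : S.IsLeaderVertex w.round w)
    (hvw : v.round ≤ w.round) : S.LeaderReach w v := by
  obtain ⟨t, i, hmem, hleader, -, hquorum⟩ := hv
  exact hD.leaderReach hact.rbc ((dagInv_run hact t i).isLocalDag.accepted v hmem) hleader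
    (not_verifiedTC_of_quorum_supporters hn hact (evidenceGenuine_run hact t i) hquorum)
    hw hwleader hvw

end Committable

/-! ## The sequence of committed leader vertices -/

open Classical in
/-- The round `r` leader vertex to which `v` has a leader path, if there is one. -/
noncomputable def reachableLeader (S : System n Tx) (v : Vertex n Tx) (r : ℕ) :
    Option (Vertex n Tx) :=
  if h : ∃ u, S.IsLeaderVertex r u ∧ S.LeaderReach v u then some h.choose else none

/-- The leader vertices that `commit_leader` finds on the way from `v` down through the rounds
`r, r - 1, …, lo + 1`, in increasing order of rounds. -/
noncomputable def descend (S : System n Tx) (lo : ℕ) : ℕ → Vertex n Tx → List (Vertex n Tx)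
  | 0, _ => []
  | r + 1, v =>
    if lo < r + 1 then
      match S.reachableLeader v (r + 1) with
      | some u => descend S lo r u ++ [u]
      | none => descend S lo r v
    else []

/-- The leader vertices that a party has committed in total once it has directly committed `v`. -/
noncomputable def leaderSeq (S : System n Tx) (v : Vertex n Tx) : List (Vertex n Tx) :=
  S.descend 0 (v.round - 1) v ++ [v]

theorem isLeaderVertex_and_leaderReach_of_reachableLeader_eq_some {v u : Vertex n Tx} {r : ℕ}
    (h : S.reachableLeader v r = some u) : S.IsLeaderVertex r u ∧ S.LeaderReach v u := by
  unfold reachableLeader at h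
  split_ifs at h with hex
  exact Option.some_inj.1 h ▸ hex.choose_spec

theorem leaderReach_of_mem_descend {lo r : ℕ} {v w : Vertex n Tx}
    (hv : S.IsLeaderVertex v.round v) (hw : w ∈ S.descend lo r v) : S.LeaderReach v w := by
  induction r generalizing v with
  | zero => simp [descend] at hw
  | succ r ih =>
    unfold descend at hw
    split_ifs at hw
    on_goal 2 => simp at hw
    cases hu : S.reachableLeader v (r + 1) with
    | none => exact ih hv (by simpa only [hu] using hw)
    | some u =>
      obtain ⟨hleader, hvu⟩ := isLeaderVertex_and_leaderReach_of_reachableLeader_eq_some hu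
      simp only [hu, List.mem_append, List.mem_singleton] at hw
      rcases hw with hw | rfl
      · exact hvu.trans (ih (hleader.1 ▸ hleader) hw)
      · exact hvu

theorem leaderReach_of_mem_leaderSeq {v w : Vertex n Tx} (hv : S.IsLeaderVertex v.round v)
    (hw : w ∈ S.leaderSeq v) : S.LeaderReach v w := by
  rcases List.mem_append.1 hw with hw | hw
  · exact leaderReach_of_mem_descend hv hw
  · obtain rfl := List.mem_singleton.1 hw
    exact ⟨hv, .refl⟩

namespace IsLocalDag

variable {D : Finset (Vertex n Tx)}

theorem eq_of_isLeaderVertex (hD : S.IsLocalDag act D) (hrbc : S.ReliableBroadcast act) {r : ℕ}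
    {v u : Vertex n Tx} (hv : v ∈ D) (hu : u ∈ D) (hvr : S.IsLeaderVertex r v)
    (hur : S.IsLeaderVertex r u) : v = u :=
  (hD.accepted v hv).eq_of_isLeaderVertex hrbc (hD.accepted u hu) hvr hur

theorem reachableLeader_eq_some_iff (hD : S.IsLocalDag act D) (hrbc : S.ReliableBroadcast act)
    {v u : Vertex n Tx} (hv : v ∈ D) {r : ℕ} :
    S.reachableLeader v r = some u ↔ S.IsLeaderVertex r u ∧ S.LeaderReach v u := by
  refine ⟨isLeaderVertex_and_leaderReach_of_reachableLeader_eq_some, fun h => ?_⟩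
  have hex : ∃ u, S.IsLeaderVertex r u ∧ S.LeaderReach v u := ⟨u, h⟩
  have hmem (u) (hu : S.LeaderReach v u) : u ∈ D := hD.closed.mem_of_reach hv hu.reach
  rw [reachableLeader, dif_pos hex, Option.some_inj]
  exact hD.eq_of_isLeaderVertex hrbc (hmem _ hex.choose_spec.2) (hmem u h.2) hex.choose_spec.1 h.1

theorem getLeader_eq_some_iff {s : LocalState n Tx} (hs : S.IsLocalDag act s.dag)
    (hrbc : S.ReliableBroadcast act) {r : ℕ} {u : Vertex n Tx} :
    S.getLeader s r = some u ↔ u ∈ s.dag ∧ S.IsLeaderVertex r u := by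
  unfold getLeader
  constructor
  · intro h
    split_ifs at h with hex
    exact Option.some_inj.1 h ▸ hex.choose_spec
  · intro h
    have hex : S.HasLeader s r := ⟨u, h⟩
    rw [dif_pos hex, Option.some_inj]
    exact hs.eq_of_isLeaderVertex hrbc hex.choose_spec.1 h.1 hex.choose_spec.2 h.2

theorem pushLeaders_eq {s : LocalState n Tx} (hs : S.IsLocalDag act s.dag)
    (hrbc : S.ReliableBroadcast act) (r : ℕ) {v : Vertex n Tx} (hv : v ∈ s.dag)
    (stack : List (Vertex n Tx)) :
    S.pushLeaders s r v stack = S.descend s.committedRound r v ++ stack := by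
  induction r generalizing v stack with
  | zero => rfl
  | succ r ih =>
    unfold pushLeaders descend
    split_ifs
    on_goal 2 => rfl
    cases hreachable : S.reachableLeader v (r + 1) with
    | some u =>
      obtain ⟨hu, hvu⟩ := (hs.reachableLeader_eq_some_iff hrbc hv).1 hreachable
      have hmem := hs.closed.mem_of_reach hv hvu.reach
      simp only [(hs.getLeader_eq_some_iff hrbc).2 ⟨hmem, hu⟩, hs.closed.leaderPath_iff hv, hvu,
        if_true, ih hmem, List.append_assoc, List.singleton_append]
    | none =>
      cases hget : S.getLeader s (r + 1) with
      | none => exact ih hv stack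
      | some u =>
        have hu := ((hs.getLeader_eq_some_iff hrbc).1 hget).2
        have hvu : ¬ S.LeaderPath s.dag v u := fun hvu => by
          simpa [hreachable] using (hs.reachableLeader_eq_some_iff hrbc hv).2
            ⟨hu, (hs.closed.leaderPath_iff hv).1 hvu⟩
        simpa only [hvu, if_false] using ih hv stack

theorem descend_zero_eq_append (hD : S.IsLocalDag act D) (hrbc : S.ReliableBroadcast act)
    {v₀ v : Vertex n Tx} (hround : 1 ≤ v₀.round) (hv₀ : S.IsLeaderVertex v₀.round v₀)
    (hreach : ∀ w ∈ D, S.IsLeaderVertex w.round w → v₀.round ≤ w.round → S.LeaderReach w v₀)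
    {r : ℕ} (hr : v₀.round ≤ r) (hv : v ∈ D) (hvv₀ : S.LeaderReach v v₀) :
    S.descend 0 r v = S.leaderSeq v₀ ++ S.descend v₀.round r v := by
  induction r generalizing v with
  | zero => omega
  | succ r ih =>
    unfold descend
    rw [if_pos r.succ_pos]
    rcases hr.eq_or_lt with heq | hlt
    · rw [← heq, (hD.reachableLeader_eq_some_iff hrbc hv).2 ⟨hv₀, hvv₀⟩, if_neg (lt_irrefl _)]
      simp [leaderSeq, heq]
    · rw [if_pos hlt]
      have hr' : v₀.round ≤ r := Nat.le_of_lt_succ hlt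
      cases hreachable : S.reachableLeader v (r + 1) with
      | none => exact ih hr' hv hvv₀
      | some u =>
        obtain ⟨hu, hvu⟩ := (hD.reachableLeader_eq_some_iff hrbc hv).1 hreachable
        have hmem := hD.closed.mem_of_reach hv hvu.reach
        have huv₀ := hreach u hmem (hu.1 ▸ hu) (hu.1 ▸ hr)
        dsimp only
        rw [ih hr' hmem huv₀, List.append_assoc]

end IsLocalDag

/-- `L` is the sequence of leader vertices committed by a party whose last direct commit is in round
`r`, where `r = 0` stands for no commit. -/
def IsCommitSeq (S : System n Tx) (act : ℕ → Action n Tx) (r : ℕ) (L : List (Vertex n Tx)) :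
    Prop :=
  (r = 0 ∧ L = []) ∨ ∃ v, S.Committable act v ∧ v.round = r ∧ L = S.leaderSeq v

theorem IsCommitSeq.leaderSeq_eq_append (hn : S.byz.card + 2 * S.f < n) (hact : S.IsExecution act)
    {r : ℕ} {L : List (Vertex n Tx)} (hL : S.IsCommitSeq act r L) {v : Vertex n Tx}
    (hv : S.Committable act v) (hr : r < v.round) :
    S.leaderSeq v = L ++ (S.descend r (v.round - 1) v ++ [v]) := by
  rcases hL with ⟨rfl, rfl⟩ | ⟨v₀, hv₀, rfl, rfl⟩
  · rfl
  · obtain ⟨D, hmem, hD⟩ := hv.exists_isLocalDag hact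
    obtain ⟨D₀, hmem₀, hD₀⟩ := hv₀.exists_isLocalDag hact
    rw [leaderSeq, ← List.append_assoc,
      hD.descend_zero_eq_append hact.rbc (hD₀.accepted v₀ hmem₀).wellFormed.1 hv₀.isLeaderVertex
        (fun _ => hv₀.leaderReach hn hact hD) (by omega) hmem
        (hv₀.leaderReach hn hact hD hmem hv.isLeaderVertex hr.le)]

theorem IsCommitSeq.prefix (hn : S.byz.card + 2 * S.f < n) (hact : S.IsExecution act)
    {r r' : ℕ} {L L' : List (Vertex n Tx)} (hL : S.IsCommitSeq act r L)
    (hL' : S.IsCommitSeq act r' L') (hr : r ≤ r') : L <+: L' := by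
  rcases hL' with ⟨rfl, rfl⟩ | ⟨v', hv', rfl, rfl⟩
  · rcases hL with ⟨-, rfl⟩ | ⟨v, ⟨_, _, -, -, hlt, -⟩, rfl, -⟩
    · exact List.prefix_rfl
    · omega
  rcases hr.eq_or_lt with heq | hlt
  · rcases hL with ⟨-, rfl⟩ | ⟨v, hv, rfl, rfl⟩
    · exact List.nil_prefix
    · obtain ⟨D, hmem, hD⟩ := hv.exists_isLocalDag hact
      obtain ⟨D', hmem', hD'⟩ := hv'.exists_isLocalDag hact
      obtain rfl := (hD.accepted v hmem).eq_of_isLeaderVertex hact.rbc (hD'.accepted v' hmem')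
        hv.isLeaderVertex (heq ▸ hv'.isLeaderVertex)
      exact List.prefix_rfl
  · exact ⟨_, (hL.leaderSeq_eq_append hn hact hv' hlt).symm⟩

/-! ## The outputs as a function of the committed leader vertices -/

/-- The arguments of the `a_deliver` by which `v` is output. -/
def delivery (v : Vertex n Tx) : List Tx × ℕ × Fin n := (v.block, v.round, v.source)

/-- The vertices delivered after those of `l` when the leader vertex `w` is processed, appended to
`l`. -/
noncomputable def deliverHistory (S : System n Tx) (l : List (Vertex n Tx)) (w : Vertex n Tx) :
    List (Vertex n Tx) :=
  l ++ S.order (history w \ l.toFinset)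

/-- The vertices delivered when the leader vertices `L` are processed, in the order of their
delivery. -/
noncomputable def deliveryOrder (S : System n Tx) (L : List (Vertex n Tx)) : List (Vertex n Tx) :=
  L.foldl S.deliverHistory []

theorem deliveryOrder_prefix {L L' : List (Vertex n Tx)} (h : L <+: L') :
    S.deliveryOrder L <+: S.deliveryOrder L' := by
  obtain ⟨K, rfl⟩ := h
  induction K using List.reverseRecOn with
  | nil => rw [List.append_nil]
  | append_singleton K w ih =>
    rw [← List.append_assoc, deliveryOrder, deliveryOrder, List.foldl_concat]
    exact ih.trans (List.prefix_append _ _)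

theorem nodup_deliveryOrder (S : System n Tx) (L : List (Vertex n Tx)) :
    (S.deliveryOrder L).Nodup := by
  induction L using List.reverseRecOn with
  | nil => exact List.nodup_nil
  | append_singleton L w ih =>
    rw [deliveryOrder, List.foldl_concat]
    refine ih.append (S.order_nodup _) fun u hu hnew => ?_
    rw [S.mem_order, Finset.mem_sdiff, List.mem_toFinset] at hnew
    exact hnew.2 hu

theorem exists_reach_of_mem_deliveryOrder {L : List (Vertex n Tx)} {u : Vertex n Tx}
    (hu : u ∈ S.deliveryOrder L) : ∃ w ∈ L, Reach w u := by
  induction L using List.reverseRecOn with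
  | nil => simp [deliveryOrder] at hu
  | append_singleton L w ih =>
    rw [deliveryOrder, List.foldl_concat] at hu
    rcases List.mem_append.1 hu with hu | hu
    · obtain ⟨w', hw', hreach⟩ := ih hu
      exact ⟨w', List.mem_append_left _ hw', hreach⟩
    · rw [S.mem_order, Finset.mem_sdiff, mem_history] at hu
      exact ⟨w, List.mem_concat_self, hu.1⟩

/-- The party has delivered exactly the vertices of `l`, in this order. -/
def HasDelivered (s : LocalState n Tx) (l : List (Vertex n Tx)) : Prop :=
  s.delivered = l.toFinset ∧ s.out = l.map delivery

section HasDelivered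

variable {s : LocalState n Tx} {l : List (Vertex n Tx)}

theorem HasDelivered.orderHistory (h : HasDelivered s l) (hs : RefClosed s.dag) {w : Vertex n Tx}
    (hw : w ∈ s.dag) : HasDelivered (S.orderHistory s w) (S.deliverHistory l w) := by
  classical
  have hnew : s.dag.filter (fun u => Path s.dag w u ∧ u ∉ s.delivered) =
      history w \ l.toFinset := by
    ext u
    rw [Finset.mem_filter, Finset.mem_sdiff, mem_history, hs.path_iff hw, h.1]
    exact and_iff_right_of_imp fun hu => hs.mem_of_reach hw hu.1
  have hset (A : Finset (Vertex n Tx)) : (S.order A).toFinset = A := by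
    ext u
    rw [List.mem_toFinset, S.mem_order]
  have heq : S.orderHistory s w = { s with
      delivered := s.delivered ∪ history w \ l.toFinset
      out := s.out ++ (S.order (history w \ l.toFinset)).map delivery } := by
    rw [← hnew]
    unfold System.orderHistory
    dsimp only
    congr!
  rw [heq]
  constructor
  · rw [deliverHistory, List.toFinset_append, hset, ← h.1]
  · rw [deliverHistory, List.map_append, ← h.2]

theorem HasDelivered.foldl_orderHistory (h : HasDelivered s l) (hs : RefClosed s.dag)
    {L : List (Vertex n Tx)} (hL : ∀ w ∈ L, w ∈ s.dag) :
    HasDelivered (L.foldl S.orderHistory s) (L.foldl S.deliverHistory l) := by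
  induction L generalizing s l with
  | nil => exact h
  | cons w L ih =>
    obtain ⟨hw, hL⟩ := List.forall_mem_cons.1 hL
    exact ih (h.orderHistory hs hw) hs hL

theorem HasDelivered.commitLeader (h : HasDelivered s l) (hs : S.IsLocalDag act s.dag)
    (hrbc : S.ReliableBroadcast act) {v : Vertex n Tx} (hv : v ∈ s.dag)
    (hleader : S.IsLeaderVertex v.round v) :
    HasDelivered (S.commitLeader s v)
      ((S.descend s.committedRound (v.round - 1) v ++ [v]).foldl S.deliverHistory l) := by
  rw [System.commitLeader, hs.pushLeaders_eq hrbc _ hv]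
  refine foldl_orderHistory (s := { s with committedRound := v.round }) h hs.closed fun w hw => ?_
  rcases List.mem_append.1 hw with hw | hw
  · exact hs.closed.mem_of_reach hv (leaderReach_of_mem_descend hleader hw).reach
  · exact List.mem_singleton.1 hw ▸ hv

end HasDelivered

/-- What a party has delivered is determined by the sequence of leader vertices that it has
committed. -/
def OutputInv (S : System n Tx) (act : ℕ → Action n Tx) (s : LocalState n Tx) : Prop :=
  ∃ L, S.IsCommitSeq act s.committedRound L ∧ HasDelivered s (S.deliveryOrder L)

theorem OutputInv.commitLeader (hn : S.byz.card + 2 * S.f < n) (hact : S.IsExecution act) {t : ℕ}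
    {i : Fin n} (h : S.OutputInv act ((S.run act t).loc i)) {v : Vertex n Tx}
    (hv : S.MayCommit ((S.run act t).loc i) v) :
    S.OutputInv act (S.commitLeader ((S.run act t).loc i) v) := by
  obtain ⟨L, hL, hdelivered⟩ := h
  have hcommittable : S.Committable act v := ⟨t, i, hv⟩
  obtain ⟨hmem, hleader, hlt, -⟩ := hv
  have hround : (S.commitLeader ((S.run act t).loc i) v).committedRound = v.round := by
    obtain ⟨_, _, heq⟩ := exists_commitLeader_eq S ((S.run act t).loc i) v
    rw [heq]
  refine ⟨S.leaderSeq v, .inr ⟨v, hcommittable, hround.symm, rfl⟩, ?_⟩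
  rw [hL.leaderSeq_eq_append hn hact hcommittable hlt, deliveryOrder, List.foldl_append]
  exact hdelivered.commitLeader (dagInv_run hact t i).isLocalDag hact.rbc hmem hleader

theorem outputInv_next (hn : S.byz.card + 2 * S.f < n) (hact : S.IsExecution act) {t : ℕ}
    (h : ∀ i, S.OutputInv act ((S.run act t).loc i)) :
    ∀ i, S.OutputInv act ((S.run act (t + 1)).loc i) := by
  have hen := hact.enabled t
  rw [run]
  cases ha : act t with rw [ha] at hen
  | idle => exact h
  | receive i p m =>
    obtain ⟨_, _, _, _, _, _, heq⟩ := exists_onReceive_eq S ((S.run act t).loc i) p m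
    exact forall_loc_upd h (heq ▸ h i) _
  | rDeliver i v r k =>
    obtain ⟨_, _, _, -, heq⟩ :=
      exists_onDeliver_eq S (S.run act t).net ((S.run act t).loc i) v r k
    exact forall_loc_upd h (heq ▸ h i) _
  | commit i v => exact forall_loc_upd h ((h i).commitLeader hn hact hen.2) _
  | _ i =>
    refine forall_loc_upd h ?_ _
    exact h i

theorem outputInv_run (hn : S.byz.card + 2 * S.f < n) (hact : S.IsExecution act) (t : ℕ)
    (i : Fin n) : S.OutputInv act ((S.run act t).loc i) := by
  induction t generalizing i with
  | zero => exact ⟨[], .inl ⟨rfl, rfl⟩, rfl, rfl⟩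
  | succ t ih => exact outputInv_next hn hact ih i

theorem out_prefix_or_prefix (hn : S.byz.card + 2 * S.f < n) (hact : S.IsExecution act)
    (i j : Fin n) (t t' : ℕ) : ((S.run act t).loc i).out <+: ((S.run act t').loc j).out ∨
      ((S.run act t').loc j).out <+: ((S.run act t).loc i).out := by
  obtain ⟨L, hL, -, hout⟩ := outputInv_run hn hact t i
  obtain ⟨L', hL', -, hout'⟩ := outputInv_run hn hact t' j
  rw [hout, hout']
  exact (le_total _ _).imp
    (fun hr => (deliveryOrder_prefix (hL.prefix hn hact hL' hr)).map delivery)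
    (fun hr => (deliveryOrder_prefix (hL'.prefix hn hact hL hr)).map delivery)

theorem IsCommitSeq.accepted_of_mem_deliveryOrder (hact : S.IsExecution act) {r : ℕ}
    {L : List (Vertex n Tx)} (hL : S.IsCommitSeq act r L) {u : Vertex n Tx}
    (hu : u ∈ S.deliveryOrder L) : S.Accepted act u := by
  obtain ⟨w, hw, hwu⟩ := exists_reach_of_mem_deliveryOrder hu
  rcases hL with ⟨-, rfl⟩ | ⟨v, hv, -, rfl⟩
  · simp at hw
  · obtain ⟨D, hmem, hD⟩ := hv.exists_isLocalDag hact
    have hvw := (leaderReach_of_mem_leaderSeq hv.isLeaderVertex hw).reach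
    exact hD.accepted u (hD.closed.mem_of_reach hmem (hvw.trans hwu))

theorem nodup_out (hn : S.byz.card + 2 * S.f < n) (hact : S.IsExecution act) (i : Fin n) (t : ℕ) :
    ((S.run act t).loc i).out.Nodup := by
  obtain ⟨L, hL, -, hout⟩ := outputInv_run hn hact t i
  rw [hout]
  refine (S.nodup_deliveryOrder L).map_on fun u hu v hv heq => ?_
  obtain ⟨-, hround, hsource⟩ : _ ∧ u.round = v.round ∧ u.source = v.source := by
    simpa only [delivery, Prod.mk.injEq] using heq
  exact (hL.accepted_of_mem_deliveryOrder hact hu).eq_of_round_source hact.rbc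
    (hL.accepted_of_mem_deliveryOrder hact hv) hround hsource

/-! ## Total order -/

theorem totalOrder_outputsBefore (hn : S.byz.card + 2 * S.f < n) (hact : S.IsExecution act) :
    S.TotalOrder (S.OutputsBefore act) := by
  have hfirst {i x y} (h : S.OutputsBefore act i x y) :
      ∃ t, OccursBefore ((S.run act t).loc i).out x y := by
    obtain ⟨t, l₁, l₂, hout, hx⟩ := h
    exact ⟨t, occursBefore_of_nodup (nodup_out hn hact i t) hout hx⟩
  intro i j hi hj x y hxy hyx
  exact totalOrder_of_prefix_or_prefix (out_prefix_or_prefix hn hact) i j hi hj x y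
    (hfirst hxy) (hfirst hyx)

theorem totalOrder_outputsBlockBefore (hn : S.byz.card + 2 * S.f < n)
    (hact : S.IsExecution act) : S.TotalOrder (S.OutputsBlockBefore act) :=
  totalOrder_of_prefix_or_prefix
    (out := fun i t => ((S.run act t).loc i).out.map fun o => (o.1, o.2.2))
    fun i j t t' => (out_prefix_or_prefix hn hact i j t t').imp (·.map _) (·.map _)

theorem leadersReachCommitted (hn : S.byz.card + 2 * S.f < n) (hact : S.IsExecution act) :
    S.LeadersReachCommitted act := by
  intro t i v ht j _ t' w hw hleader hlt
  have hen := hact.enabled t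
  rw [ht] at hen
  have hv : S.Committable act v := ⟨t, i, hen.2⟩
  have hD := (dagInv_run hact t' j).isLocalDag
  exact (hD.closed.leaderPath_iff hw).2 (hv.leaderReach hn hact hD hw hleader hlt.le)

end System

end Angelfish

theorem mainTheorem6_general {Tx : Type*} {n : ℕ} (S : Angelfish.System n Tx)
    (hn : S.byz.card + 2 * S.f < n) (act : ℕ → Angelfish.Action n Tx) (hact : S.IsExecution act) :
    S.TotalOrder (S.OutputsBefore act) ∧
    S.TotalOrder (S.OutputsBlockBefore act) ∧
    S.LeadersReachCommitted act :=
  ⟨Angelfish.System.totalOrder_outputsBefore hn hact,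
    Angelfish.System.totalOrder_outputsBlockBefore hn hact,
    Angelfish.System.leadersReachCommitted hn hact⟩

/-- In every execution of single-leader Angelfish with `n > 3f` parties, of which at most `f` are
Byzantine, Total order holds, and directly committed leader vertices stay reachable by leader
paths from all later leader vertices. -/
theorem mainTheorem6 {Tx : Type*} {n : ℕ} (S : Angelfish.System n Tx)
    (hf : 3 * S.f < n) (hbyz : S.byz.card ≤ S.f)
    (act : ℕ → Angelfish.Action n Tx) (hact : S.IsExecution act) :
    S.TotalOrder (S.OutputsBefore act) ∧
    S.TotalOrder (S.OutputsBlockBefore act) ∧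
    S.LeadersReachCommitted act :=
  mainTheorem6_general S (by omega) act hact
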